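/- Let $\mathbb{H}$ be the quaternions and $\mathbb{B}=\{q\in\mathbb{H}:|q|<1\}$. A function $f:\mathbb{B}\to\mathbb{H}$ is called regular if, for every $I\in\mathbb{H}$ with $I^2=-1$, its restriction to $\mathbb{B}\cap(\mathbb{R}+I\mathbb{R})$ is real differentiable and $\frac12\left(\frac{\partial}{\partial x}+I\frac{\partial}{\partial y}\right)f(x+Iy)=0$ there. Its Cullen derivative is $\partial_c f(x+Iy)=\frac12\left(\frac{\partial}{\partial x}-I\frac{\partial}{\partial y}\right)f(x+Iy)$, and $\partial_c^m$ denotes the $m$-th iterate of $\partial_c$. Regular functions on $\mathbb{B}$ are the sums $f(q)=\sum_{k} q^k a_k$ of power series converging in $\mathbb{B}$, with $a_k\in\mathbb{H}$; for $f=\sum_k q^ka_k$ and $g=\sum_k q^kb_k$ put $$f*g(q)=\sum_{k}q^k\sum_{j=0}^k a_jb_{k-j},\qquad f^c(q)=\sum_k q^k\overline{a_k},\qquad f^s=f*f^c,$$ $$g*f^{-*}(q)=f^s(q)^{-1}\,(g*f^c)(q)\quad\text{where } f^s(q)\neq0.$$ Write $f^{*n}$ for the $*$-product of $n$ copies of $f$,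 and $f^{-*n}=(f^{*n})^{-*}$. A quaternion inside a $*$-product stands for the constant function, and $q$ for the identity function. Theorem. Let $f:\mathbb{B}\to\mathbb{B}$ be regular, let $q_0\in\mathbb{B}$ and let $n\ge1$ be an integer. Suppose that $\partial_c^mf(q_0)=0$ for all $1\le m\le n-1$. Then the symmetrization of $1-\overline{f(q_0)}*f$ has no zeros in $\mathbb{B}$, so that right quotients by $1-\overline{f(q_0)}*f$ are defined on all of $\mathbb{B}$; for all $q\in\mathbb{B}$ $$\left|(f(q)-f(q_0))*(1-\overline{f(q_0)}*f(q))^{-*}\right|\le\left|(q-q_0)^{*n}*(1-\overline{q_0}*q)^{-*n}\right|;$$ and, evaluating at $q_0$, $$\left|\partial_c^nf*(1-\overline{f(q_0)}*f)^{-*}\right|_{|_{q_0}}\le\frac{n!}{(1-|q_0|^2)^n}.$$ -/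

import Mathlib

open scoped Quaternion Nat

noncomputable section

namespace SliceRegular

/-- The open unit ball of the quaternions. -/
def unitBall : Set ℍ[ℝ] := Metric.ball 0 1

/-- (Cullen, or slice) regularity of `f` on an open set `Ω`: for every imaginary unit `I`, the
restriction of `f` to the slice `Ω ∩ (ℝ + I ℝ)` is real differentiable, and
`(1/2) (∂/∂x + I ∂/∂y) f (x + I y)` vanishes there.
The partial derivatives at `x + I y` are the line derivatives in the directions `1` and `I`. -/
def IsRegularOn (f : ℍ[ℝ] → ℍ[ℝ]) (Ω : Set ℍ[ℝ]) : Prop :=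
  ∀ I : ℍ[ℝ], I ^ 2 = -1 → ∀ x y : ℝ, (x : ℍ[ℝ]) + y • I ∈ Ω →
    DifferentiableAt ℝ (fun p : ℝ × ℝ => f ((p.1 : ℍ[ℝ]) + p.2 • I)) (x, y) ∧
    (1 / 2 : ℝ) • (lineDeriv ℝ f ((x : ℍ[ℝ]) + y • I) 1
      + I * lineDeriv ℝ f ((x : ℍ[ℝ]) + y • I) I) = 0

/-- The quaternion `i`. -/
def iUnit : ℍ[ℝ] := ⟨0, 1, 0, 0⟩

/-- An imaginary unit `I` such that `q` lies in `ℝ + I ℝ`: the direction of the imaginary part of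
`q`, or the unit `i` when `q` is real. -/
def imUnit (q : ℍ[ℝ]) : ℍ[ℝ] :=
  open Classical in if q.im = 0 then iUnit else ‖q.im‖⁻¹ • q.im

/-- The Cullen derivative `(1/2) (∂/∂x - I ∂/∂y) f (x + I y)` at `q = x + I y`. For regular
functions it does not depend on the choice of `I` at real points, see `cullenDeriv_eq`. -/
def cullenDeriv (f : ℍ[ℝ] → ℍ[ℝ]) (q : ℍ[ℝ]) : ℍ[ℝ] :=
  (1 / 2 : ℝ) • (lineDeriv ℝ f q 1 - imUnit q * lineDeriv ℝ f q (imUnit q))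

/-- `f` is the sum on the unit ball of the power series `∑ qⁿ aₙ`. -/
def HasSeries (f : ℍ[ℝ] → ℍ[ℝ]) (a : ℕ → ℍ[ℝ]) : Prop :=
  ∀ q ∈ unitBall, HasSum (fun n => q ^ n * a n) (f q)

/-- The coefficients of the power series of `f` on the unit ball (they are unique, see
`HasSeries.coeff_eq`). -/
def coeff (f : ℍ[ℝ] → ℍ[ℝ]) : ℕ → ℍ[ℝ] :=
  open Classical in if h : ∃ a, HasSeries f a then h.choose else 0

/-- Regular multiplication of `f = ∑ qⁿ aₙ` and `g = ∑ qⁿ bₙ`: the power series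
`∑ qⁿ (∑ₖ aₖ bₙ₋ₖ)`. -/
def starMul (f g : ℍ[ℝ] → ℍ[ℝ]) (q : ℍ[ℝ]) : ℍ[ℝ] :=
  ∑' n : ℕ, q ^ n * ∑ k ∈ Finset.range (n + 1), coeff f k * coeff g (n - k)

/-- The `*`-product of `n` copies of `f`. -/
def starPow (f : ℍ[ℝ] → ℍ[ℝ]) : ℕ → ℍ[ℝ] → ℍ[ℝ]
  | 0 => fun _ => 1
  | n + 1 => starMul (starPow f n) f

/-- The regular conjugate `∑ qⁿ (star aₙ)` of `f = ∑ qⁿ aₙ`. -/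
def conj (f : ℍ[ℝ] → ℍ[ℝ]) (q : ℍ[ℝ]) : ℍ[ℝ] :=
  ∑' n : ℕ, q ^ n * star (coeff f n)

/-- The symmetrization `fˢ = f * fᶜ`. -/
def symm (f : ℍ[ℝ] → ℍ[ℝ]) : ℍ[ℝ] → ℍ[ℝ] := starMul f (conj f)

/-- The right regular quotient `g * h⁻*`, with value `hˢ(q)⁻¹ (g * hᶜ)(q)`; it is meaningful off the
zero set of `hˢ`. -/
def starDiv (g h : ℍ[ℝ] → ℍ[ℝ]) (q : ℍ[ℝ]) : ℍ[ℝ] :=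
  (symm h q)⁻¹ * starMul g (conj h) q

/-- The function `q ↦ 1 - a̅ * f(q)`, where `a̅ * f` is the regular product of a constant and `f`. -/
def oneSubStar (a : ℍ[ℝ]) (f : ℍ[ℝ] → ℍ[ℝ]) (q : ℍ[ℝ]) : ℍ[ℝ] :=
  1 - starMul (fun _ => star a) f q

theorem HasSeries.unique {f : ℍ[ℝ] → ℍ[ℝ]} {a b : ℕ → ℍ[ℝ]}
    (ha : HasSeries f a) (hb : HasSeries f b) : a = b := by
  let P : (ℕ → ℍ[ℝ]) → FormalMultilinearSeries ℝ ℝ ℍ[ℝ] := fun c n =>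
    ContinuousMultilinearMap.mkPiRing ℝ (Fin n) (c n)
  have hP : ∀ c n, (P c).coeff n = c n := by
    intro c n
    rw [FormalMultilinearSeries.coeff]
    exact (ContinuousMultilinearMap.mkPiRing_apply _ _).trans (by simp)
  have key : ∀ c : ℕ → ℍ[ℝ], HasSeries f c →
      HasFPowerSeriesAt (fun x : ℝ => f (x : ℍ[ℝ])) (P c) 0 := by
    intro c hc
    refine hasFPowerSeriesAt_iff.mpr ?_
    filter_upwards [Metric.ball_mem_nhds (0 : ℝ) one_pos] with x hx
    have hxb : (x : ℍ[ℝ]) ∈ unitBall := by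
      simpa [unitBall] using hx
    have h := hc _ hxb
    simp only [hP, zero_add]
    have e : (fun n => (x : ℍ[ℝ]) ^ n * c n) = fun n => x ^ n • c n := by
      funext n
      rw [← Quaternion.coe_pow, Quaternion.coe_mul_eq_smul]
    rw [e] at h
    exact h
  have h := (key a ha).eq_formalMultilinearSeries (key b hb)
  funext n
  rw [← hP a n, h, hP]

theorem HasSeries.coeff_eq {f : ℍ[ℝ] → ℍ[ℝ]} {a : ℕ → ℍ[ℝ]} (ha : HasSeries f a) :
    coeff f = a := by
  have h : ∃ a, HasSeries f a := ⟨a, ha⟩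
  rw [coeff, dif_pos h]
  exact h.choose_spec.unique ha

theorem imUnit_sq (q : ℍ[ℝ]) : imUnit q ^ 2 = -1 := by
  by_cases h : q.im = 0
  · have h0 : imUnit q = iUnit := if_pos h
    rw [h0, sq]
    ext <;> simp <;> simp [iUnit]
  · have h0 : imUnit q = ‖q.im‖⁻¹ • q.im := if_neg h
    have h1 : q.im * q.im = -((‖q.im‖ ^ 2 : ℝ) : ℍ[ℝ]) := by
      have h2 := Quaternion.self_mul_star q.im
      rw [Quaternion.normSq_eq_norm_mul_self, Quaternion.star_im, mul_neg] at h2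
      rw [sq, ← h2, neg_neg]
    have h3 : ‖q.im‖ ≠ 0 := norm_ne_zero_iff.mpr h
    rw [h0, sq, smul_mul_smul_comm, h1, smul_neg, ← Quaternion.coe_smul, smul_eq_mul,
      show ‖q.im‖⁻¹ * ‖q.im‖⁻¹ * ‖q.im‖ ^ 2 = 1 by field_simp, Quaternion.coe_one]

theorem eq_add_smul_imUnit (q : ℍ[ℝ]) : (q.re : ℍ[ℝ]) + ‖q.im‖ • imUnit q = q := by
  have hq : (q.re : ℍ[ℝ]) + q.im = q := Quaternion.re_add_im q
  by_cases h : q.im = 0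
  · rw [h, add_zero] at hq
    rw [h, norm_zero, zero_smul, add_zero, hq]
  · have h0 : imUnit q = ‖q.im‖⁻¹ • q.im := if_neg h
    rw [h0, smul_smul, mul_inv_cancel₀ (norm_ne_zero_iff.mpr h), one_smul, hq]

/-- For regular `f`, the Cullen derivative is given by its formula in every slice through the
point. -/
theorem cullenDeriv_eq {f : ℍ[ℝ] → ℍ[ℝ]} {Ω : Set ℍ[ℝ]} (hf : IsRegularOn f Ω) {I : ℍ[ℝ]}
    (hI : I ^ 2 = -1) {x y : ℝ} (hq : (x : ℍ[ℝ]) + y • I ∈ Ω) :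
    cullenDeriv f ((x : ℍ[ℝ]) + y • I) = (1 / 2 : ℝ) • (lineDeriv ℝ f ((x : ℍ[ℝ]) + y • I) 1
      - I * lineDeriv ℝ f ((x : ℍ[ℝ]) + y • I) I) := by
  set q := (x : ℍ[ℝ]) + y • I with hqdef
  have h0 : (1 / 2 : ℝ) ≠ 0 := by norm_num
  have h1 : lineDeriv ℝ f q 1 + I * lineDeriv ℝ f q I = 0 :=
    (smul_eq_zero.mp (hf I hI x y hq).2).resolve_left h0
  have h2 : lineDeriv ℝ f q 1 + imUnit q * lineDeriv ℝ f q (imUnit q) = 0 := by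
    have := (hf (imUnit q) (imUnit_sq q) q.re ‖q.im‖ (by rwa [eq_add_smul_imUnit])).2
    rw [eq_add_smul_imUnit] at this
    exact (smul_eq_zero.mp this).resolve_left h0
  rw [cullenDeriv, eq_neg_of_add_eq_zero_right h1, eq_neg_of_add_eq_zero_right h2]

end SliceRegular

end

/-!
Let `η = ∑ Xⁿ aₙ` be the power series of `f`. The weighted value `E_q(η) w = ∑ qⁿ w aₙ` turns the
`*`-product into composition, `E_q(η * ψ) = E_q(ψ) ∘ E_q(η)`, so the value `v` of `κ * ψ⁻*` at `q`
is characterised by `E_q(ψ) v = E_q(κ) 1`. Since `E_q(η) w = w f(w⁻¹ q w)` for `w ≠ 0`, we have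
`‖E_q(η) w‖ ≤ ‖w‖`, and for `a = f(q₀)` the Möbius identity
`‖v + w a‖² - ‖w + v a̅‖² = (1 - ‖a‖²) (‖v‖² - ‖w‖²)` makes `(f - a) * (1 - a̅ * f)⁻*` a
contraction.

The vanishing derivatives give `f - a = (q - q₀)^{*n} * ρ`. Each factor `q - q₀` may be replaced by
`1 - q̄₀ * q` without losing the contraction property: the two factors agree in modulus in the
limit on spheres of radius tending to `1`, and the maximum modulus principle on the slices carries
the bound inside. The resulting bound on `(1 - q̄₀ * q)^{*n} * ρ * (1 - a̅ * f)⁻*` yields both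
inequalities.
-/

noncomputable section

namespace SliceRegular

open PowerSeries (X C)
open Finset.HasAntidiagonal (antidiagonal mem_antidiagonal)
open scoped PowerSeries Topology

section Algebra

variable {R : Type*} [Semiring R]

/-- The formal derivative `∑ Xⁿ (n + 1) aₙ₊₁` of `∑ Xⁿ aₙ`, over a possibly noncommutative
semiring. On regular functions it is the Cullen derivative. -/
def derivative : R⟦X⟧ →+ R⟦X⟧ where
  toFun η := PowerSeries.mk fun n => (n + 1) • PowerSeries.coeff (n + 1) η
  map_zero' := by ext n; simp
  map_add' η ψ := by ext n; simp

theorem coeff_derivative (η : R⟦X⟧) (n : ℕ) :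
    PowerSeries.coeff n (derivative η) = (n + 1) • PowerSeries.coeff (n + 1) η := by
  simp [derivative]

theorem derivative_mul (η ψ : R⟦X⟧) :
    derivative (η * ψ) = derivative η * ψ + η * derivative ψ := by
  ext n
  simp only [coeff_derivative, PowerSeries.coeff_mul, map_add]
  have hleft : ∑ p ∈ antidiagonal n,
        (p.1 + 1) • PowerSeries.coeff (p.1 + 1) η * PowerSeries.coeff p.2 ψ =
      ∑ p ∈ antidiagonal (n + 1),
        p.1 • (PowerSeries.coeff p.1 η * PowerSeries.coeff p.2 ψ) := by
    simp [Finset.Nat.sum_antidiagonal_succ, mul_assoc]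
  have hright : ∑ p ∈ antidiagonal n,
        PowerSeries.coeff p.1 η * (p.2 + 1) • PowerSeries.coeff (p.2 + 1) ψ =
      ∑ p ∈ antidiagonal (n + 1),
        p.2 • (PowerSeries.coeff p.1 η * PowerSeries.coeff p.2 ψ) := by
    simp only [Finset.Nat.sum_antidiagonal_succ', zero_smul, zero_add, mul_smul_comm]
  rw [hleft, hright, ← Finset.sum_add_distrib, Finset.smul_sum]
  refine Finset.sum_congr rfl fun p hp => ?_
  rw [← add_smul, mem_antidiagonal.mp hp]

theorem derivative_C (a : R) : derivative (C a) = 0 := by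
  ext n
  simp [coeff_derivative]

theorem derivative_X : derivative (X : R⟦X⟧) = 1 := by
  ext n
  rcases n with - | n <;> simp [coeff_derivative, PowerSeries.coeff_X, PowerSeries.coeff_one]

end Algebra

section AlgebraRing

variable {R : Type*} [Ring R]

theorem iterate_derivative_sub_C (η : R⟦X⟧) (a : R) {m : ℕ} (hm : m ≠ 0) :
    derivative^[m] (η - C a) = derivative^[m] η := by
  obtain ⟨k, rfl⟩ := Nat.exists_eq_succ_of_ne_zero hm
  rw [Function.iterate_succ_apply, Function.iterate_succ_apply, map_sub, derivative_C, sub_zero]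

theorem iterate_derivative_X_sub_C_mul (a : R) (ρ : R⟦X⟧) (k : ℕ) :
    derivative^[k + 1] ((X - C a) * ρ) =
      (k + 1) • derivative^[k] ρ + (X - C a) * derivative^[k + 1] ρ := by
  have derivative_X_sub_C_mul (κ : R⟦X⟧) :
      derivative ((X - C a) * κ) = κ + (X - C a) * derivative κ := by
    rw [derivative_mul, map_sub, derivative_X, derivative_C, sub_zero, one_mul]
  induction k with
  | zero => simp [derivative_X_sub_C_mul]
  | succ k ih =>
    rw [Function.iterate_succ_apply', ih, map_add, map_nsmul, derivative_X_sub_C_mul,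
      ← Function.iterate_succ_apply' derivative, ← Function.iterate_succ_apply' derivative,
      succ_nsmul _ (k + 1), add_assoc]

end AlgebraRing

section StarRing

variable {R : Type*} [Semiring R] [StarRing R]

/-- The power series `∑ Xⁿ (star aₙ)`, representing the regular conjugate of `∑ Xⁿ aₙ`. -/
def conjSeries (η : R⟦X⟧) : R⟦X⟧ :=
  PowerSeries.mk fun n => star (PowerSeries.coeff n η)

theorem coeff_conjSeries (η : R⟦X⟧) (n : ℕ) :
    PowerSeries.coeff n (conjSeries η) = star (PowerSeries.coeff n η) :=
  PowerSeries.coeff_mk _ _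

theorem conjSeries_conjSeries (η : R⟦X⟧) : conjSeries (conjSeries η) = η := by
  ext n
  rw [coeff_conjSeries, coeff_conjSeries, star_star]

theorem conjSeries_mul (η ψ : R⟦X⟧) : conjSeries (η * ψ) = conjSeries ψ * conjSeries η := by
  ext n
  rw [coeff_conjSeries, PowerSeries.coeff_mul, PowerSeries.coeff_mul, star_sum,
    ← Finset.Nat.sum_antidiagonal_swap]
  simp only [coeff_conjSeries, star_mul, Prod.fst_swap, Prod.snd_swap]

end StarRing

theorem commute_X_sub_C_one_sub_C_mul_X {R : Type*} [Ring R] {a b : R} (h : Commute a b) :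
    Commute (X - C a) (1 - C b * X) := by
  have hXC (c : R) : Commute X (C c) := (PowerSeries.commute_X (C c)).symm
  have hX : Commute (X - C a) X := (Commute.refl X).sub_left (hXC a).symm
  have hC : Commute (X - C a) (C b) := (hXC b).sub_left (h.map C)
  exact (Commute.one_right _).sub_right (hC.mul_right hX)

theorem norm_sum_antidiagonal_mul_pow_le {R : Type*} [NormedRing R] (a b : ℕ → R) {r : ℝ}
    (hr : 0 ≤ r) (n : ℕ) :
    ‖∑ p ∈ antidiagonal n, a p.1 * b p.2‖ * r ^ n ≤
      ∑ p ∈ antidiagonal n, ‖a p.1‖ * r ^ p.1 * (‖b p.2‖ * r ^ p.2) := by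
  refine (mul_le_mul_of_nonneg_right (norm_sum_le _ _) (pow_nonneg hr n)).trans ?_
  rw [Finset.sum_mul]
  refine Finset.sum_le_sum fun p hp => ?_
  rw [mul_mul_mul_comm, ← pow_add, mem_antidiagonal.mp hp]
  gcongr
  exact norm_mul_le _ _

/-- The subring of the power series that converge absolutely on the open unit ball. -/
def convergentSeries (R : Type*) [NormedRing R] : Subring R⟦X⟧ where
  carrier := {η | ∀ r : ℝ, 0 ≤ r → r < 1 → Summable fun n => ‖PowerSeries.coeff n η‖ * r ^ n}
  zero_mem' r _ _ := by simp [summable_zero]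
  one_mem' r _ _ := summable_of_ne_finset_zero (s := {0}) fun n hn => by
    rw [PowerSeries.coeff_one, if_neg (Finset.notMem_singleton.mp hn), norm_zero, zero_mul]
  add_mem' {η ψ} hη hψ r hr0 hr1 := by
    refine ((hη r hr0 hr1).add (hψ r hr0 hr1)).of_nonneg_of_le (fun n => by positivity) fun n => ?_
    rw [map_add, ← add_mul]
    gcongr
    exact norm_add_le _ _
  neg_mem' {η} hη r hr0 hr1 := by simpa only [map_neg, norm_neg] using hη r hr0 hr1
  mul_mem' {η ψ} hη hψ r hr0 hr1 := by
    refine (summable_norm_sum_mul_antidiagonal_of_summable_norm (hη r hr0 hr1).norm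
      (hψ r hr0 hr1).norm).of_nonneg_of_le (fun n => by positivity) fun n => ?_
    rw [PowerSeries.coeff_mul]
    exact (norm_sum_antidiagonal_mul_pow_le (fun k => PowerSeries.coeff k η)
      (fun k => PowerSeries.coeff k ψ) hr0 n).trans (le_abs_self _)

section Convergence

variable {R : Type*} [NormedRing R]

theorem mem_convergentSeries {η : R⟦X⟧} :
    η ∈ convergentSeries R ↔
      ∀ r : ℝ, 0 ≤ r → r < 1 → Summable fun n => ‖PowerSeries.coeff n η‖ * r ^ n :=
  Iff.rfl

theorem C_mem_convergentSeries (a : R) : C a ∈ convergentSeries R := fun r _ _ =>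
  summable_of_ne_finset_zero (s := {0}) fun n hn => by
    rw [PowerSeries.coeff_C, if_neg (Finset.notMem_singleton.mp hn), norm_zero, zero_mul]

theorem X_mem_convergentSeries : (X : R⟦X⟧) ∈ convergentSeries R := fun r _ _ =>
  summable_of_ne_finset_zero (s := {1}) fun n hn => by
    rw [PowerSeries.coeff_X, if_neg (Finset.notMem_singleton.mp hn), norm_zero, zero_mul]

theorem X_sub_C_mem_convergentSeries (a : R) : X - C a ∈ convergentSeries R :=
  sub_mem X_mem_convergentSeries (C_mem_convergentSeries a)

theorem one_sub_C_mul_mem_convergentSeries {η : R⟦X⟧} (hη : η ∈ convergentSeries R) (a : R) :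
    1 - C a * η ∈ convergentSeries R :=
  sub_mem (one_mem _) (mul_mem (C_mem_convergentSeries a) hη)

theorem exists_norm_coeff_mul_pow_le {η : R⟦X⟧} (hη : η ∈ convergentSeries R) {r : ℝ}
    (hr0 : 0 ≤ r) (hr1 : r < 1) : ∃ B, ∀ n, ‖PowerSeries.coeff n η‖ * r ^ n ≤ B :=
  ⟨_, fun n => (hη r hr0 hr1).le_tsum n fun _ _ => by positivity⟩

theorem mem_convergentSeries_of_bounded {η : R⟦X⟧}
    (h : ∀ r : ℝ, 0 < r → r < 1 → ∃ B, ∀ n, ‖PowerSeries.coeff n η‖ * r ^ n ≤ B) :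
    η ∈ convergentSeries R := by
  intro r hr0 hr1
  obtain ⟨s, hrs, hs1⟩ := exists_between hr1
  have hs0 : 0 < s := hr0.trans_lt hrs
  obtain ⟨B, hB⟩ := h s hs0 hs1
  refine Summable.of_nonneg_of_le (fun n => by positivity) (fun n => ?_)
    ((summable_geometric_of_lt_one (div_nonneg hr0 hs0.le)
      ((div_lt_one hs0).mpr hrs)).mul_left B)
  calc ‖PowerSeries.coeff n η‖ * r ^ n
      = ‖PowerSeries.coeff n η‖ * s ^ n * (r / s) ^ n := by
        rw [mul_assoc, ← mul_pow, mul_div_cancel₀ _ hs0.ne']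
    _ ≤ B * (r / s) ^ n := by gcongr; exact hB n

theorem derivative_mem_convergentSeries {η : R⟦X⟧} (hη : η ∈ convergentSeries R) :
    derivative η ∈ convergentSeries R := by
  intro r hr0 hr1
  obtain ⟨s, hrs, hs1⟩ := exists_between hr1
  have hs0 : 0 < s := hr0.trans_lt hrs
  obtain ⟨B, hB⟩ := exists_norm_coeff_mul_pow_le hη hs0.le hs1
  have hgeom : ‖r / s‖ < 1 := by
    rwa [Real.norm_of_nonneg (div_nonneg hr0 hs0.le), div_lt_one hs0]
  have hsum : Summable fun n : ℕ => B / s * ((n + 1 : ℝ) * (r / s) ^ n) := by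
    refine Summable.mul_left _ ?_
    simpa [add_mul] using (summable_pow_mul_geometric_of_norm_lt_one 1 hgeom).add
      (summable_geometric_of_norm_lt_one hgeom)
  refine hsum.of_nonneg_of_le (fun n => by positivity) fun n => ?_
  rw [coeff_derivative]
  calc ‖(n + 1) • PowerSeries.coeff (n + 1) η‖ * r ^ n
      ≤ (n + 1 : ℝ) * ‖PowerSeries.coeff (n + 1) η‖ * r ^ n := by
        gcongr
        exact_mod_cast norm_nsmul_le (n := n + 1) (a := PowerSeries.coeff (n + 1) η)
    _ = ‖PowerSeries.coeff (n + 1) η‖ * s ^ (n + 1) / s * ((n + 1 : ℝ) * (r / s) ^ n) := by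
        rw [div_pow, pow_succ]
        field_simp
    _ ≤ B / s * ((n + 1 : ℝ) * (r / s) ^ n) := by gcongr; exact hB _

theorem iterate_derivative_mem_convergentSeries {η : R⟦X⟧} (hη : η ∈ convergentSeries R) (k : ℕ) :
    derivative^[k] η ∈ convergentSeries R := by
  induction k with
  | zero => exact hη
  | succ k ih =>
    rw [Function.iterate_succ_apply']
    exact derivative_mem_convergentSeries ih

theorem conjSeries_mem_convergentSeries [StarRing R] [NormedStarGroup R] {η : R⟦X⟧}
    (hη : η ∈ convergentSeries R) : conjSeries η ∈ convergentSeries R := by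
  simpa only [mem_convergentSeries, coeff_conjSeries, norm_star] using hη

end Convergence

section Eval

variable {R : Type*} [NormedRing R]

/-- The weighted value `∑ qⁿ w aₙ` of the power series `η = ∑ Xⁿ aₙ`. The case `w = 1` is the value
at `q` of the regular function with series `η`; in a division ring, the value for `w ≠ 0` is
`w * η (w⁻¹ * q * w)`. -/
def eval (η : R⟦X⟧) (q w : R) : R :=
  ∑' n : ℕ, q ^ n * w * PowerSeries.coeff n η

theorem eval_C (a q w : R) : eval (C a) q w = w * a := by
  rw [eval, tsum_eq_single 0 fun n hn => by rw [PowerSeries.coeff_C, if_neg hn, mul_zero]]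
  simp

theorem eval_one (q w : R) : eval 1 q w = w := by
  simpa using eval_C 1 q w

theorem eval_X (q w : R) : eval X q w = q * w := by
  rw [eval, tsum_eq_single 1 fun n hn => by rw [PowerSeries.coeff_X, if_neg hn, mul_zero]]
  simp

theorem eval_zero_right (η : R⟦X⟧) (q : R) : eval η q 0 = 0 := by
  simp [eval]

theorem norm_pow_mul_mul_le [NormOneClass R] (q w c : R) (n : ℕ) :
    ‖q ^ n * w * c‖ ≤ ‖w‖ * (‖c‖ * ‖q‖ ^ n) :=
  calc ‖q ^ n * w * c‖ ≤ ‖q‖ ^ n * ‖w‖ * ‖c‖ :=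
        (norm_mul₃_le).trans (by gcongr; exact norm_pow_le q n)
    _ = ‖w‖ * (‖c‖ * ‖q‖ ^ n) := by ring

variable [NormOneClass R] {η ψ : R⟦X⟧} {q : R}

theorem summable_norm_eval (hη : η ∈ convergentSeries R) (hq : ‖q‖ < 1) (w : R) :
    Summable fun n => ‖q ^ n * w * PowerSeries.coeff n η‖ :=
  ((hη ‖q‖ (norm_nonneg q) hq).mul_left ‖w‖).of_nonneg_of_le (fun _ => norm_nonneg _)
    fun n => norm_pow_mul_mul_le q w _ n

variable [CompleteSpace R]

theorem summable_eval (hη : η ∈ convergentSeries R) (hq : ‖q‖ < 1) (w : R) :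
    Summable fun n => q ^ n * w * PowerSeries.coeff n η :=
  (summable_norm_eval hη hq w).of_norm

theorem eval_add (hη : η ∈ convergentSeries R) (hψ : ψ ∈ convergentSeries R) (hq : ‖q‖ < 1)
    (w : R) : eval (η + ψ) q w = eval η q w + eval ψ q w := by
  simp only [eval, map_add, mul_add]
  exact (summable_eval hη hq w).tsum_add (summable_eval hψ hq w)

theorem eval_sub (hη : η ∈ convergentSeries R) (hψ : ψ ∈ convergentSeries R) (hq : ‖q‖ < 1)
    (w : R) : eval (η - ψ) q w = eval η q w - eval ψ q w := by
  simp only [eval, map_sub, mul_sub]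
  exact (summable_eval hη hq w).tsum_sub (summable_eval hψ hq w)

theorem eval_add_right (hη : η ∈ convergentSeries R) (hq : ‖q‖ < 1) (v w : R) :
    eval η q (v + w) = eval η q v + eval η q w := by
  simp only [eval, mul_add, add_mul]
  exact (summable_eval hη hq v).tsum_add (summable_eval hη hq w)

theorem eval_nsmul (hη : η ∈ convergentSeries R) (hq : ‖q‖ < 1) (k : ℕ) (w : R) :
    eval (k • η) q w = k • eval η q w := by
  simp only [eval, map_nsmul, mul_smul_comm]
  exact (summable_eval hη hq w).tsum_const_smul k

theorem eval_smul_right [NormedAlgebra ℝ R] (hη : η ∈ convergentSeries R) (hq : ‖q‖ < 1) (r : ℝ)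
    (w : R) : eval η q (r • w) = r • eval η q w := by
  simp only [eval, mul_smul_comm, smul_mul_assoc]
  exact (summable_eval hη hq w).tsum_const_smul r

theorem eval_mul (hη : η ∈ convergentSeries R) (hψ : ψ ∈ convergentSeries R) (hq : ‖q‖ < 1)
    (w : R) : eval (η * ψ) q w = eval ψ q (eval η q w) := by
  let F : ℕ × ℕ → R := fun p =>
    q ^ p.2 * (q ^ p.1 * w * PowerSeries.coeff p.1 η) * PowerSeries.coeff p.2 ψ
  have hF : Summable F := by
    refine (Summable.mul_of_nonneg (summable_norm_eval hη hq w)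
      (hψ ‖q‖ (norm_nonneg q) hq) (fun _ => norm_nonneg _) (fun _ => by positivity)).of_norm_bounded
      fun p => norm_pow_mul_mul_le q _ _ p.2
  have hdiagonals : ∑' p, F p = eval (η * ψ) q w := by
    rw [← Finset.HasAntidiagonal.sigmaAntidiagonalEquivProd.tsum_eq F]
    refine (Summable.tsum_sigma' (fun n => (hasSum_fintype _).summable)
      (Finset.HasAntidiagonal.sigmaAntidiagonalEquivProd.summable_iff.mpr hF)).trans
      (tsum_congr fun n => ?_)
    rw [tsum_fintype, PowerSeries.coeff_mul, Finset.mul_sum]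
    refine (Finset.sum_coe_sort (antidiagonal n) F).trans (Finset.sum_congr rfl fun p hp => ?_)
    simp only [F, ← mem_antidiagonal.mp hp, add_comm p.1, pow_add, mul_assoc]
  have hcolumns : ∑' p, F p = eval ψ q (eval η q w) := by
    rw [← (Equiv.prodComm ℕ ℕ).tsum_eq F]
    refine ((Equiv.prodComm ℕ ℕ).summable_iff.mpr hF).tsum_prod.trans (tsum_congr fun n => ?_)
    have hcolumn := summable_eval hη hq w
    exact ((hcolumn.mul_left (q ^ n)).tsum_mul_right _).trans
      (congrArg (· * PowerSeries.coeff n ψ) (hcolumn.tsum_mul_left _))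
  rw [← hdiagonals, hcolumns]

theorem eval_X_sub_C (hq : ‖q‖ < 1) (a w : R) : eval (X - C a) q w = q * w - w * a := by
  rw [eval_sub X_mem_convergentSeries (C_mem_convergentSeries a) hq, eval_X, eval_C]

theorem eval_one_sub_C_mul (hη : η ∈ convergentSeries R) (hq : ‖q‖ < 1) (a w : R) :
    eval (1 - C a * η) q w = w - eval η q (w * a) := by
  rw [eval_sub (one_mem _) (mul_mem (C_mem_convergentSeries a) hη) hq, eval_one,
    eval_mul (C_mem_convergentSeries a) hη hq, eval_C]

end Eval

section DivisionRing

variable {D : Type*} [NormedDivisionRing D]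

theorem eval_eq_mul_eval_conj (η : D⟦X⟧) (q : D) {w : D} (hw : w ≠ 0) :
    eval η q w = w * eval η (w⁻¹ * q * w) 1 := by
  rw [eval, eval, ← tsum_mul_left]
  refine tsum_congr fun n => ?_
  rw [GroupWithZero.conj_pow₀ hw, mul_one, ← mul_assoc, ← mul_assoc, mul_inv_cancel_left₀ hw]

theorem norm_eval_le_of_forall_eval_one {η : D⟦X⟧} {r B : ℝ}
    (h : ∀ q, ‖q‖ < r → ‖eval η q 1‖ ≤ B) {q : D} (hq : ‖q‖ < r) (w : D) :
    ‖eval η q w‖ ≤ B * ‖w‖ := by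
  rcases eq_or_ne w 0 with rfl | hw
  · simp [eval_zero_right]
  have hconj : ‖w⁻¹ * q * w‖ < r := by
    rwa [norm_mul, norm_mul, norm_inv, mul_right_comm,
      inv_mul_cancel₀ (norm_ne_zero_iff.mpr hw), one_mul]
  rw [eval_eq_mul_eval_conj η q hw, norm_mul, mul_comm]
  gcongr
  exact h _ hconj

end DivisionRing

section LinearFactors

variable {R : Type*} [NormedRing R] [NormOneClass R] {η : R⟦X⟧} {a : R}

theorem norm_pow_mul_coeff_shift_le {s B : ℝ} (hs : 0 < s)
    (hB : ∀ n, ‖PowerSeries.coeff n η‖ * s ^ n ≤ B) (a : R) (n k : ℕ) :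
    ‖a ^ k * PowerSeries.coeff (n + k) η‖ ≤ B / s ^ n * (‖a‖ / s) ^ k :=
  calc ‖a ^ k * PowerSeries.coeff (n + k) η‖
      ≤ ‖a‖ ^ k * ‖PowerSeries.coeff (n + k) η‖ :=
        (norm_mul_le _ _).trans (by gcongr; exact norm_pow_le a k)
    _ = ‖PowerSeries.coeff (n + k) η‖ * s ^ (n + k) / s ^ n * (‖a‖ / s) ^ k := by
        rw [pow_add, div_pow]
        field_simp
    _ ≤ B / s ^ n * (‖a‖ / s) ^ k := by gcongr; exact hB _

/-- The quotient `∑ₙ Xⁿ ∑ₖ aᵏ cₙ₊₁₊ₖ` of the left division of `η = ∑ Xⁿ cₙ` by `X - a`. -/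
def divXSubC (η : R⟦X⟧) (a : R) : R⟦X⟧ :=
  PowerSeries.mk fun n => ∑' k, a ^ k * PowerSeries.coeff (n + 1 + k) η

theorem divXSubC_mem_convergentSeries (hη : η ∈ convergentSeries R) (ha : ‖a‖ < 1) :
    divXSubC η a ∈ convergentSeries R := by
  refine mem_convergentSeries_of_bounded fun r hr0 hr1 => ?_
  obtain ⟨s, hrs, hs1⟩ := exists_between (max_lt hr1 ha)
  have hs0 : 0 < s := hr0.trans ((le_max_left _ _).trans_lt hrs)
  have has : ‖a‖ / s < 1 := (div_lt_one hs0).mpr ((le_max_right _ _).trans_lt hrs)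
  obtain ⟨B, hB⟩ := exists_norm_coeff_mul_pow_le hη hs0.le hs1
  have hcoeff (n : ℕ) :
      ‖PowerSeries.coeff n (divXSubC η a)‖ ≤ B / s ^ (n + 1) * (1 - ‖a‖ / s)⁻¹ := by
    rw [divXSubC, PowerSeries.coeff_mk]
    exact tsum_of_norm_bounded ((hasSum_geometric_of_lt_one (by positivity) has).mul_left _)
      fun k => norm_pow_mul_coeff_shift_le hs0 hB a (n + 1) k
  refine ⟨B / s * (1 - ‖a‖ / s)⁻¹, fun n => ?_⟩
  calc ‖PowerSeries.coeff n (divXSubC η a)‖ * r ^ n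
      ≤ ‖PowerSeries.coeff n (divXSubC η a)‖ * s ^ n := by
        gcongr
        exact (le_max_left _ _).trans hrs.le
    _ ≤ B / s ^ (n + 1) * (1 - ‖a‖ / s)⁻¹ * s ^ n := by gcongr; exact hcoeff n
    _ = B / s * (1 - ‖a‖ / s)⁻¹ := by
        rw [pow_succ]
        field_simp

variable [CompleteSpace R]

theorem summable_pow_mul_coeff_shift (hη : η ∈ convergentSeries R) (ha : ‖a‖ < 1) (n : ℕ) :
    Summable fun k => a ^ k * PowerSeries.coeff (n + k) η := by
  obtain ⟨s, has, hs1⟩ := exists_between ha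
  have hs0 : 0 < s := (norm_nonneg a).trans_lt has
  obtain ⟨B, hB⟩ := exists_norm_coeff_mul_pow_le hη hs0.le hs1
  exact ((summable_geometric_of_lt_one (by positivity)
    ((div_lt_one hs0).mpr has)).mul_left _).of_norm_bounded
    fun k => norm_pow_mul_coeff_shift_le hs0 hB a n k

theorem X_sub_C_mul_divXSubC (hη : η ∈ convergentSeries R) (ha : ‖a‖ < 1) :
    (X - C a) * divXSubC η a = η - C (eval η a 1) := by
  have htail (n : ℕ) : ∑' k, a ^ k * PowerSeries.coeff (n + k) η =
      PowerSeries.coeff n η + a * ∑' k, a ^ k * PowerSeries.coeff (n + 1 + k) η := by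
    rw [(summable_pow_mul_coeff_shift hη ha n).tsum_eq_zero_add,
      ← (summable_pow_mul_coeff_shift hη ha (n + 1)).tsum_mul_left]
    simp only [pow_zero, one_mul, add_zero, pow_succ', mul_assoc, add_assoc, add_comm 1]
  ext n
  rcases n with - | n
  · have hvalue : eval η a 1 =
        PowerSeries.coeff 0 η + a * ∑' k, a ^ k * PowerSeries.coeff (0 + 1 + k) η := by
      simpa [eval] using htail 0
    simp [sub_mul, hvalue, divXSubC]
  · simp [sub_mul, PowerSeries.coeff_succ_X_mul, divXSubC, htail (n + 1)]

theorem eval_X_sub_C_mul_self {ρ : R⟦X⟧} (hρ : ρ ∈ convergentSeries R) (ha : ‖a‖ < 1) :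
    eval ((X - C a) * ρ) a 1 = 0 := by
  rw [eval_mul (X_sub_C_mem_convergentSeries a) hρ ha, eval_X_sub_C ha, mul_one, one_mul, sub_self,
    eval_zero_right]

theorem eval_iterate_derivative_X_sub_C_mul_self {ρ : R⟦X⟧} (hρ : ρ ∈ convergentSeries R)
    (ha : ‖a‖ < 1) (k : ℕ) :
    eval (derivative^[k + 1] ((X - C a) * ρ)) a 1 = (k + 1) • eval (derivative^[k] ρ) a 1 := by
  have hk := iterate_derivative_mem_convergentSeries hρ k
  have hk' := iterate_derivative_mem_convergentSeries hρ (k + 1)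
  rw [iterate_derivative_X_sub_C_mul,
    eval_add (nsmul_mem hk _) (mul_mem (X_sub_C_mem_convergentSeries a) hk') ha,
    eval_nsmul hk ha, eval_X_sub_C_mul_self hk' ha, add_zero]

theorem exists_eq_X_sub_C_pow_mul [IsAddTorsionFree R] (hη : η ∈ convergentSeries R) (ha : ‖a‖ < 1)
    (n : ℕ) (hvanish : ∀ m < n, eval (derivative^[m] η) a 1 = 0) :
    ∃ ρ ∈ convergentSeries R, η = (X - C a) ^ n * ρ ∧
      eval (derivative^[n] η) a 1 = n ! • eval ρ a 1 := by
  induction n generalizing η with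
  | zero => exact ⟨η, hη, by simp, by simp⟩
  | succ n ih =>
    have hκ := divXSubC_mem_convergentSeries hη ha
    have hfactor : η = (X - C a) * divXSubC η a := by
      have hvalue : eval η a 1 = 0 := hvanish 0 n.succ_pos
      rw [X_sub_C_mul_divXSubC hη ha, hvalue, map_zero, sub_zero]
    have hderiv (k : ℕ) : eval (derivative^[k + 1] η) a 1 =
        (k + 1) • eval (derivative^[k] (divXSubC η a)) a 1 := by
      conv_lhs => rw [hfactor]
      exact eval_iterate_derivative_X_sub_C_mul_self hκ ha k
    obtain ⟨ρ, hρ, hκρ, hlead⟩ := ih hκ fun m hm =>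
      (nsmul_eq_zero_iff_right m.succ_ne_zero).mp
        ((hderiv m).symm.trans (hvanish (m + 1) (Nat.succ_lt_succ hm)))
    refine ⟨ρ, hρ, ?_, ?_⟩
    · rw [pow_succ', mul_assoc, ← hκρ, ← hfactor]
    · rw [hderiv, hlead, ← mul_smul, Nat.factorial_succ]

end LinearFactors

section OneVariable

theorem eq_of_eventually_hasSum_pow_smul {𝕜 E : Type*} [NontriviallyNormedField 𝕜]
    [NormedAddCommGroup E] [NormedSpace 𝕜 E] {a b : ℕ → E} {g : 𝕜 → E}
    (ha : ∀ᶠ x in 𝓝 0, HasSum (fun n => x ^ n • a n) (g x))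
    (hb : ∀ᶠ x in 𝓝 0, HasSum (fun n => x ^ n • b n) (g x)) : a = b := by
  let series (c : ℕ → E) : FormalMultilinearSeries 𝕜 𝕜 E := fun n =>
    ContinuousMultilinearMap.mkPiRing 𝕜 (Fin n) (c n)
  have coeff_series (c : ℕ → E) (n : ℕ) : (series c).coeff n = c n := by
    simp [series, FormalMultilinearSeries.coeff]
  have hasFPowerSeriesAt {c : ℕ → E} (hc : ∀ᶠ x in 𝓝 0, HasSum (fun n => x ^ n • c n) (g x)) :
      HasFPowerSeriesAt g (series c) 0 :=
    hasFPowerSeriesAt_iff.mpr (by simpa only [coeff_series, zero_add] using hc)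
  funext n
  rw [← coeff_series a, (hasFPowerSeriesAt ha).eq_formalMultilinearSeries (hasFPowerSeriesAt hb),
    coeff_series]

theorem hasDerivAt_tsum_pow_smul {𝕜 E : Type*} [RCLike 𝕜] [NormedAddCommGroup E] [NormedSpace 𝕜 E]
    [CompleteSpace E] {c : ℕ → E} (hc : ∀ r : ℝ, 0 ≤ r → r < 1 → Summable fun n => ‖c n‖ * r ^ n)
    {z : 𝕜} (hz : ‖z‖ < 1) :
    HasDerivAt (fun z => ∑' n, z ^ n • c n) (∑' n, z ^ n • (n + 1) • c (n + 1)) z := by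
  obtain ⟨r, hzr, hr1⟩ := exists_between hz
  have hr0 : 0 ≤ r := (norm_nonneg z).trans hzr.le
  have hnorms : PowerSeries.mk (fun n => ‖c n‖) ∈ convergentSeries ℝ := by
    simpa [mem_convergentSeries] using hc
  have hbound : Summable fun n : ℕ => n * r ^ (n - 1) * ‖c n‖ := by
    refine (summable_nat_add_iff 1).mp
      ((derivative_mem_convergentSeries hnorms r hr0 hr1).congr fun n => ?_)
    simp only [coeff_derivative, PowerSeries.coeff_mk, nsmul_eq_mul, norm_mul, norm_norm,
      Real.norm_natCast, Nat.add_sub_cancel]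
    ring
  have hterm (n : ℕ) (y : 𝕜) : HasDerivAt (fun y => y ^ n • c n) ((n * y ^ (n - 1)) • c n) y :=
    (hasDerivAt_pow n y).smul_const (c n)
  have hterm_le (n : ℕ) (y : 𝕜) (hy : y ∈ Metric.ball 0 r) :
      ‖((n : 𝕜) * y ^ (n - 1)) • c n‖ ≤ n * r ^ (n - 1) * ‖c n‖ := by
    rw [norm_smul, norm_mul, RCLike.norm_natCast, norm_pow]
    gcongr
    exact (mem_ball_zero_iff.mp hy).le
  have hzball : z ∈ Metric.ball (0 : 𝕜) r := mem_ball_zero_iff.mpr hzr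
  have hsummable : Summable fun n => z ^ n • c n := by
    refine (hc r hr0 hr1).of_norm_bounded fun n => ?_
    rw [norm_smul, norm_pow, mul_comm]
    gcongr
  convert hasDerivAt_tsum_of_isPreconnected hbound Metric.isOpen_ball
    (convex_ball (0 : 𝕜) r).isPreconnected (fun n y _ => hterm n y) hterm_le hzball hsummable hzball
    using 1
  rw [(hbound.of_norm_bounded fun n => hterm_le n z hzball).tsum_eq_zero_add]
  simp [mul_smul, smul_comm (z ^ _), ← Nat.cast_smul_eq_nsmul 𝕜]

theorem differentiableAt_complex_of_fderiv_I {E : Type*} [NormedAddCommGroup E] [NormedSpace ℝ E]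
    [NormedSpace ℂ E] [IsScalarTower ℝ ℂ E] {F : ℂ → E} {z : ℂ} (hF : DifferentiableAt ℝ F z)
    (hI : fderiv ℝ F z Complex.I = Complex.I • fderiv ℝ F z 1) : DifferentiableAt ℂ F z := by
  refine (differentiableAt_iff_restrictScalars ℝ hF).mpr
    ⟨ContinuousLinearMap.toSpanSingleton ℂ (fderiv ℝ F z 1), ?_⟩
  ext w
  have hw : w = w.re • 1 + w.im • Complex.I := by
    simp only [Complex.real_smul, mul_one, Complex.re_add_im]
  change w • fderiv ℝ F z 1 = fderiv ℝ F z w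
  calc w • fderiv ℝ F z 1 = (w.re • 1 + w.im • Complex.I) • fderiv ℝ F z 1 := by rw [← hw]
    _ = fderiv ℝ F z (w.re • 1 + w.im • Complex.I) := by
      rw [map_add, map_smul, map_smul, hI, add_smul, smul_assoc, smul_assoc, one_smul]
    _ = fderiv ℝ F z w := by rw [← hw]

end OneVariable

section Slices

theorem star_eq_neg_of_sq_eq_neg_one {I : ℍ[ℝ]} (hI : I ^ 2 = -1) : star I = -I := by
  have hnorm : ‖I‖ ^ 2 = 1 := by rw [← norm_pow, hI, norm_neg, norm_one]
  rw [Quaternion.star_eq_neg, ← Quaternion.sq_eq_neg_normSq, Quaternion.normSq_eq_norm_mul_self,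
    ← sq, hnorm, hI, Quaternion.coe_one]

variable {I : ℍ[ℝ]} (hI : I ^ 2 = -1)

/-- The embedding `x + y i ↦ x + y I` of the complex numbers onto the slice `ℝ + ℝ I`. -/
def sliceHom : ℂ →ₐ[ℝ] ℍ[ℝ] :=
  Complex.lift ⟨I, by rw [← sq, hI]⟩

theorem sliceHom_apply (z : ℂ) : sliceHom hI z = (z.re : ℍ[ℝ]) + z.im • I := by
  simp [sliceHom, Complex.liftAux_apply]

theorem sliceHom_I : sliceHom hI Complex.I = I := by
  simp [sliceHom_apply]

theorem sliceHom_ofReal (x : ℝ) : sliceHom hI x = x := by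
  simp

theorem star_sliceHom (z : ℂ) : star (sliceHom hI z) = sliceHom hI (star z) := by
  simp [sliceHom_apply, star_eq_neg_of_sq_eq_neg_one hI]

theorem norm_sliceHom (z : ℂ) : ‖sliceHom hI z‖ = ‖z‖ := by
  refine (mul_self_inj (norm_nonneg _) (norm_nonneg _)).mp (Quaternion.coe_injective ?_)
  rw [← Quaternion.normSq_eq_norm_mul_self, ← Quaternion.self_mul_star, star_sliceHom, ← map_mul,
    Complex.star_def, Complex.mul_conj, sliceHom_ofReal, Complex.normSq_eq_norm_sq, sq]

theorem exists_sliceHom_eq (q : ℍ[ℝ]) :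
    ∃ z : ℂ, sliceHom (imUnit_sq q) z = q :=
  ⟨⟨q.re, ‖q.im‖⟩, by rw [sliceHom_apply, eq_add_smul_imUnit]⟩

/-- The quaternions as a complex vector space, `z` acting as left multiplication by
`sliceHom hI z`. -/
abbrev sliceModule : NormedSpace ℂ ℍ[ℝ] where
  toModule := Module.compHom ℍ[ℝ] (sliceHom hI).toRingHom
  norm_smul_le z q := by
    change ‖sliceHom hI z * q‖ ≤ _
    rw [norm_mul, norm_sliceHom]

theorem sliceModule_isScalarTower : letI := sliceModule hI; IsScalarTower ℝ ℂ ℍ[ℝ] :=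
  letI := sliceModule hI
  ⟨fun r z q => by
    change sliceHom hI (r • z) * q = r • (sliceHom hI z * q)
    rw [map_smul, smul_mul_assoc]⟩

end Slices

section Represents

theorem mem_unitBall {q : ℍ[ℝ]} : q ∈ unitBall ↔ ‖q‖ < 1 := by
  rw [unitBall, mem_ball_zero_iff]

/-- `f` is the sum of the power series `η` on the unit ball. -/
def Represents (η : ℍ[ℝ]⟦X⟧) (f : ℍ[ℝ] → ℍ[ℝ]) : Prop :=
  HasSeries f fun n => PowerSeries.coeff n η

variable {η ψ : ℍ[ℝ]⟦X⟧} {f g : ℍ[ℝ] → ℍ[ℝ]}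

theorem Represents.mem_convergentSeries (h : Represents η f) : η ∈ convergentSeries ℍ[ℝ] := by
  refine mem_convergentSeries_of_bounded fun r hr0 hr1 => ?_
  have hr : (r : ℍ[ℝ]) ∈ unitBall := by
    rwa [mem_unitBall, Quaternion.norm_coe, Real.norm_of_nonneg hr0.le]
  obtain ⟨B, hB⟩ := (h r hr).summable.tendsto_atTop_zero.norm.bddAbove_range
  refine ⟨B, fun n => le_of_eq_of_le ?_ (hB ⟨n, rfl⟩)⟩
  simp only [norm_mul, norm_pow, Quaternion.norm_coe, Real.norm_of_nonneg hr0.le, mul_comm]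

theorem represents_of_eval_eq (hη : η ∈ convergentSeries ℍ[ℝ])
    (hf : ∀ q ∈ unitBall, eval η q 1 = f q) : Represents η f := by
  intro q hq
  rw [← hf q hq]
  simpa only [eval, mul_one] using (summable_eval hη (mem_unitBall.mp hq) 1).hasSum

theorem Represents.eval_eq (h : Represents η f) {q : ℍ[ℝ]} (hq : q ∈ unitBall) :
    eval η q 1 = f q := by
  simpa only [eval, mul_one] using (h q hq).tsum_eq

theorem Represents.coeff_eq (h : Represents η f) : coeff f = fun n => PowerSeries.coeff n η :=
  HasSeries.coeff_eq h

theorem represents_const (a : ℍ[ℝ]) : Represents (C a) fun _ => a :=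
  represents_of_eval_eq (C_mem_convergentSeries a) fun q _ => by rw [eval_C, one_mul]

theorem represents_id : Represents X fun q => q :=
  represents_of_eval_eq X_mem_convergentSeries fun q _ => by rw [eval_X, mul_one]

theorem Represents.sub (hf : Represents η f) (hg : Represents ψ g) :
    Represents (η - ψ) fun q => f q - g q := fun q hq => by
  simpa only [map_sub, mul_sub] using (hf q hq).sub (hg q hq)

theorem Represents.starMul (hf : Represents η f) (hg : Represents ψ g) :
    Represents (η * ψ) (starMul f g) := by
  refine represents_of_eval_eq (mul_mem hf.mem_convergentSeries hg.mem_convergentSeries)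
    fun q _ => tsum_congr fun n => ?_
  rw [PowerSeries.coeff_mul, hf.coeff_eq, hg.coeff_eq, mul_one,
    Finset.Nat.sum_antidiagonal_eq_sum_range_succ_mk]

theorem Represents.starPow (hf : Represents η f) (n : ℕ) :
    Represents (η ^ n) (starPow f n) := by
  induction n with
  | zero => simpa only [pow_zero, map_one, SliceRegular.starPow] using represents_const 1
  | succ n ih => simpa only [pow_succ, SliceRegular.starPow] using ih.starMul hf

theorem Represents.conj (hf : Represents η f) : Represents (conjSeries η) (conj f) := by
  refine represents_of_eval_eq (conjSeries_mem_convergentSeries hf.mem_convergentSeries)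
    fun q _ => tsum_congr fun n => ?_
  rw [mul_one, coeff_conjSeries, hf.coeff_eq]

theorem Represents.oneSubStar (hf : Represents η f) (a : ℍ[ℝ]) :
    Represents (1 - C (star a) * η) (oneSubStar a f) := by
  have hone : Represents 1 fun _ => 1 := by simpa only [map_one] using represents_const 1
  exact hone.sub ((represents_const (star a)).starMul hf)

end Represents

section RegularFunctions

variable {I : ℍ[ℝ]} (hI : I ^ 2 = -1)

theorem hasDerivAt_eval_sliceHom {η : ℍ[ℝ]⟦X⟧} (hη : η ∈ convergentSeries ℍ[ℝ]) (w : ℍ[ℝ]) {z : ℂ}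
    (hz : ‖z‖ < 1) : letI := sliceModule hI
    HasDerivAt (fun z => eval η (sliceHom hI z) w) (eval (derivative η) (sliceHom hI z) w) z := by
  let _ := sliceModule hI
  have eval_eq (ψ : ℍ[ℝ]⟦X⟧) (z : ℂ) :
      eval ψ (sliceHom hI z) w = ∑' n, z ^ n • (w * PowerSeries.coeff n ψ) :=
    tsum_congr fun n => by rw [mul_assoc, ← map_pow]; rfl
  simp only [eval_eq, coeff_derivative, mul_smul_comm]
  refine hasDerivAt_tsum_pow_smul (fun r hr0 hr1 => ?_) hz
  simpa only [norm_mul, mul_assoc] using (hη r hr0 hr1).mul_left ‖w‖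

theorem IsRegularOn.differentiableAt_comp_sliceHom {f : ℍ[ℝ] → ℍ[ℝ]} {Ω : Set ℍ[ℝ]}
    (hf : IsRegularOn f Ω) {z : ℂ} (hz : sliceHom hI z ∈ Ω) : letI := sliceModule hI
    DifferentiableAt ℂ (f ∘ sliceHom hI) z := by
  obtain ⟨hdiff, hCR⟩ := hf I hI z.re z.im (by rwa [← sliceHom_apply])
  have hF : DifferentiableAt ℝ (f ∘ sliceHom hI) z := by
    have hslice : f ∘ sliceHom hI =
        (fun p : ℝ × ℝ => f (p.1 + p.2 • I)) ∘ Complex.equivRealProdCLM := by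
      funext z
      simp only [Function.comp_apply, sliceHom_apply, Complex.equivRealProdCLM_apply]
    rw [hslice]
    exact DifferentiableAt.comp z hdiff Complex.equivRealProdCLM.differentiableAt
  have hlineDeriv (v : ℂ) :
      lineDeriv ℝ f (sliceHom hI z) (sliceHom hI v) = fderiv ℝ (f ∘ sliceHom hI) z v :=
    ((hF.hasFDerivAt.hasLineDerivAt v).of_comp (L := (sliceHom hI).toLinearMap)).lineDeriv
  have hone := hlineDeriv 1
  have hunit := hlineDeriv Complex.I
  rw [map_one, sliceHom_apply] at hone
  rw [sliceHom_I, sliceHom_apply] at hunit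
  rw [hone, hunit] at hCR
  let _ := sliceModule hI
  have := sliceModule_isScalarTower hI
  refine differentiableAt_complex_of_fderiv_I hF ?_
  change _ = sliceHom hI Complex.I * _
  have hI_mul := (smul_eq_zero.mp hCR).resolve_left one_half_pos.ne'
  rw [sliceHom_I, eq_neg_of_add_eq_zero_left hI_mul, mul_neg, ← mul_assoc, ← sq, hI, neg_one_mul,
    neg_neg]

theorem IsRegularOn.exists_hasSum_slice {f : ℍ[ℝ] → ℍ[ℝ]} (hf : IsRegularOn f unitBall) :
    ∃ c : ℕ → ℍ[ℝ],
      ∀ z : ℂ, ‖z‖ < 1 → HasSum (fun n => sliceHom hI z ^ n * c n) (f (sliceHom hI z)) := by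
  let _ := sliceModule hI
  refine ⟨fun n => (n ! : ℂ)⁻¹ • iteratedDeriv n (f ∘ sliceHom hI) 0, fun z hz => ?_⟩
  have hdiff : DifferentiableOn ℂ (f ∘ sliceHom hI) (Metric.ball 0 1) := fun z hz =>
    (hf.differentiableAt_comp_sliceHom hI (by
      rwa [mem_unitBall, norm_sliceHom, ← mem_ball_zero_iff])).differentiableWithinAt
  refine (Complex.hasSum_taylorSeries_on_ball hdiff (mem_ball_zero_iff.mpr hz)).congr_fun
    fun n => ?_
  rw [sub_zero, smul_comm, ← map_pow]
  rfl

theorem IsRegularOn.exists_represents {f : ℍ[ℝ] → ℍ[ℝ]} (hf : IsRegularOn f unitBall) :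
    ∃ η, Represents η f := by
  choose c hc using fun q => hf.exists_hasSum_slice (imUnit_sq q)
  have hreal (q : ℍ[ℝ]) : ∀ᶠ x : ℝ in 𝓝 0, HasSum (fun n => x ^ n • c q n) (f (x : ℍ[ℝ])) := by
    filter_upwards [Metric.ball_mem_nhds (0 : ℝ) one_pos] with x hx
    have hx' : ‖(x : ℂ)‖ < 1 := by rwa [Complex.norm_real, ← mem_ball_zero_iff]
    simpa only [sliceHom_ofReal, ← Quaternion.coe_pow, Quaternion.coe_mul_eq_smul] using hc q x hx'
  refine ⟨PowerSeries.mk (c 0), fun q hq => ?_⟩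
  obtain ⟨z, hz⟩ := exists_sliceHom_eq q
  have hz1 : ‖z‖ < 1 := by rwa [← norm_sliceHom (imUnit_sq q), hz, ← mem_unitBall]
  have hsum := hc q z hz1
  rw [hz, eq_of_eventually_hasSum_pow_smul (hreal q) (hreal 0)] at hsum
  simpa only [PowerSeries.coeff_mk] using hsum

variable {η : ℍ[ℝ]⟦X⟧} {f : ℍ[ℝ] → ℍ[ℝ]}

theorem Represents.lineDeriv_sliceHom (hf : Represents η f) {z : ℂ}
    (hz : sliceHom hI z ∈ unitBall) (v : ℂ) :
    lineDeriv ℝ f (sliceHom hI z) (sliceHom hI v) =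
      sliceHom hI v * eval (derivative η) (sliceHom hI z) 1 := by
  rw [mem_unitBall, norm_sliceHom] at hz
  have heval : f ∘ sliceHom hI =ᶠ[𝓝 z] fun z => eval η (sliceHom hI z) 1 := by
    filter_upwards [Metric.isOpen_ball.mem_nhds (mem_ball_zero_iff.mpr hz)] with y hy
    exact (hf.eval_eq (by rwa [mem_unitBall, norm_sliceHom, ← mem_ball_zero_iff])).symm
  have hline : HasLineDerivAt ℝ (f ∘ sliceHom hI)
      (sliceHom hI v * eval (derivative η) (sliceHom hI z) 1) z v := by
    let _ := sliceModule hI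
    have := sliceModule_isScalarTower hI
    exact (((hasDerivAt_eval_sliceHom hI hf.mem_convergentSeries 1 hz).congr_of_eventuallyEq
      heval).hasFDerivAt.restrictScalars ℝ).hasLineDerivAt v
  exact (hline.of_comp (L := (sliceHom hI).toLinearMap)).lineDeriv

theorem Represents.cullenDeriv (hf : Represents η f) :
    Represents (derivative η) (cullenDeriv f) := by
  refine represents_of_eval_eq (derivative_mem_convergentSeries hf.mem_convergentSeries)
    fun q hq => ?_
  obtain ⟨z, hz⟩ := exists_sliceHom_eq q
  have hlineDeriv := hf.lineDeriv_sliceHom (imUnit_sq q) (hz.symm ▸ hq)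
  have hone := hlineDeriv 1
  have hunit := hlineDeriv Complex.I
  rw [map_one, hz, one_mul] at hone
  rw [sliceHom_I, hz] at hunit
  rw [SliceRegular.cullenDeriv, hone, hunit, ← mul_assoc, ← sq, imUnit_sq, neg_one_mul,
    sub_neg_eq_add, ← two_smul ℝ, smul_smul, one_div, inv_mul_cancel₀ two_ne_zero, one_smul]

theorem Represents.iterate_cullenDeriv (hf : Represents η f) (n : ℕ) :
    Represents (derivative^[n] η) (SliceRegular.cullenDeriv^[n] f) := by
  induction n with
  | zero => exact hf
  | succ n ih => simpa only [Function.iterate_succ_apply'] using ih.cullenDeriv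

end RegularFunctions

section RealCoefficients

variable {σ : ℍ[ℝ]⟦X⟧}

theorem coe_re_coeff_of_conjSeries_eq (hσ : conjSeries σ = σ) (n : ℕ) :
    ((PowerSeries.coeff n σ).re : ℍ[ℝ]) = PowerSeries.coeff n σ :=
  (Quaternion.star_eq_self.mp (by rw [← coeff_conjSeries, hσ])).symm

theorem eval_of_conjSeries_eq (hσ : conjSeries σ = σ) (q w : ℍ[ℝ]) :
    eval σ q w = eval σ q 1 * w := by
  rw [eval, eval, ← tsum_mul_right]
  refine tsum_congr fun n => ?_
  rw [← coe_re_coeff_of_conjSeries_eq hσ, mul_one, mul_assoc, mul_assoc, Quaternion.coe_commutes]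

theorem exists_differentiableOn_sliceHom_eq_eval (hσ : conjSeries σ = σ)
    (hconv : σ ∈ convergentSeries ℍ[ℝ]) {I : ℍ[ℝ]} (hI : I ^ 2 = -1) :
    ∃ s : ℂ → ℂ, DifferentiableOn ℂ s (Metric.ball 0 1) ∧
      ∀ z, ‖z‖ < 1 → sliceHom hI (s z) = eval σ (sliceHom hI z) 1 := by
  let c (n : ℕ) : ℂ := (PowerSeries.coeff n σ).re
  have sliceHom_c (n : ℕ) : sliceHom hI (c n) = PowerSeries.coeff n σ := by
    rw [sliceHom_ofReal, coe_re_coeff_of_conjSeries_eq hσ]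
  have hc (r : ℝ) (hr0 : 0 ≤ r) (hr1 : r < 1) : Summable fun n => ‖c n‖ * r ^ n := by
    simpa only [← norm_sliceHom hI, sliceHom_c] using hconv r hr0 hr1
  refine ⟨fun z => ∑' n, z ^ n • c n, fun z hz => ?_, fun z hz => ?_⟩
  · exact (hasDerivAt_tsum_pow_smul hc
      (mem_ball_zero_iff.mp hz)).differentiableAt.differentiableWithinAt
  · have hsummable : Summable fun n => z ^ n • c n := by
      refine (hc ‖z‖ (norm_nonneg z) hz).of_norm_bounded fun n => ?_
      rw [smul_eq_mul, norm_mul, norm_pow, mul_comm]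
    refine (hsummable.map_tsum (sliceHom hI)
      (sliceHom hI).toLinearMap.continuous_of_finiteDimensional).trans ?_
    exact tsum_congr fun n => by
      rw [smul_eq_mul, map_mul, map_pow, sliceHom_c, mul_one]

end RealCoefficients

theorem inner_mul_left (a v w : ℍ[ℝ]) : inner ℝ (a * v) w = inner ℝ v (star a * w) := by
  simp only [Quaternion.inner_def, star_mul, star_star, Quaternion.re_mul, Quaternion.imI_mul,
    Quaternion.imJ_mul, Quaternion.imK_mul]
  ring

theorem inner_mul_right (a v w : ℍ[ℝ]) : inner ℝ (v * a) w = inner ℝ v (w * star a) := by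
  rw [Quaternion.inner_def, Quaternion.inner_def, star_mul, star_star, mul_assoc]

section Nonsingular

variable {η κ ψ : ℍ[ℝ]⟦X⟧} {q v w : ℍ[ℝ]}

theorem inner_eval (hη : η ∈ convergentSeries ℍ[ℝ]) (hq : ‖q‖ < 1) (v w : ℍ[ℝ]) :
    inner ℝ (eval η q v) w = inner ℝ v (eval (conjSeries η) (star q) w) := by
  have hq' : ‖star q‖ < 1 := by rwa [norm_star]
  have hleft := (summable_eval hη hq v).hasSum.mapL ((innerSL ℝ).flip w)
  have hright := (summable_eval (conjSeries_mem_convergentSeries hη) hq' w).hasSum.mapL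
    (innerSL ℝ v)
  refine hleft.unique (hright.congr_fun fun n => ?_)
  change inner ℝ (q ^ n * v * PowerSeries.coeff n η) w = _
  rw [inner_mul_right, inner_mul_left, star_pow]
  simp only [innerSL_apply_apply, coeff_conjSeries, mul_assoc]

/-- `ψ` converges and all its weighted evaluation maps are injective, so that right quotients by
`ψ` are defined on the whole unit ball. -/
def IsNonsingular (ψ : ℍ[ℝ]⟦X⟧) : Prop :=
  ψ ∈ convergentSeries ℍ[ℝ] ∧ ∀ q, ‖q‖ < 1 → Function.Injective (eval ψ q)

theorem IsNonsingular.surjective (hψ : IsNonsingular ψ) (hq : ‖q‖ < 1) :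
    Function.Surjective (eval ψ q) := by
  let evalLinear : ℍ[ℝ] →ₗ[ℝ] ℍ[ℝ] :=
    { toFun := eval ψ q
      map_add' := eval_add_right hψ.1 hq
      map_smul' := eval_smul_right hψ.1 hq }
  exact LinearMap.injective_iff_surjective (f := evalLinear).mp (hψ.2 q hq)

theorem IsNonsingular.conj (hψ : IsNonsingular ψ) : IsNonsingular (conjSeries ψ) := by
  refine ⟨conjSeries_mem_convergentSeries hψ.1, fun q hq v w hvw => ext_inner_left ℝ fun u => ?_⟩
  have hq' : ‖star q‖ < 1 := by rwa [norm_star]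
  obtain ⟨t, rfl⟩ := hψ.surjective hq' u
  rw [inner_eval hψ.1 hq', inner_eval hψ.1 hq', star_star, hvw]

theorem IsNonsingular.pow (hψ : IsNonsingular ψ) (n : ℕ) : IsNonsingular (ψ ^ n) := by
  refine ⟨pow_mem hψ.1 n, fun q hq => ?_⟩
  induction n with
  | zero => exact fun v w hvw => by simpa only [pow_zero, eval_one] using hvw
  | succ n ih =>
    have heval : eval (ψ ^ (n + 1)) q = eval ψ q ∘ eval (ψ ^ n) q :=
      funext fun w => by rw [pow_succ, eval_mul (pow_mem hψ.1 n) hψ.1 hq, Function.comp_apply]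
    rw [heval]
    exact (hψ.2 q hq).comp ih

theorem conjSeries_mul_conjSeries_self (ψ : ℍ[ℝ]⟦X⟧) :
    conjSeries (ψ * conjSeries ψ) = ψ * conjSeries ψ := by
  rw [conjSeries_mul, conjSeries_conjSeries]

theorem IsNonsingular.eval_mul_conjSeries_ne_zero (hψ : IsNonsingular ψ) (hq : ‖q‖ < 1) :
    eval (ψ * conjSeries ψ) q 1 ≠ 0 := by
  rw [eval_mul hψ.1 hψ.conj.1 hq, ← eval_zero_right (conjSeries ψ) q,
    (hψ.conj.2 q hq).ne_iff, ← eval_zero_right ψ q, (hψ.2 q hq).ne_iff]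
  exact one_ne_zero

theorem IsNonsingular.inv_mul_eval_eq (hψ : IsNonsingular ψ) (hκ : κ ∈ convergentSeries ℍ[ℝ])
    (hq : ‖q‖ < 1) (h : eval ψ q v = eval κ q w) :
    (eval (ψ * conjSeries ψ) q 1)⁻¹ * eval (κ * conjSeries ψ) q w = v := by
  rw [eval_mul hκ hψ.conj.1 hq, ← h, ← eval_mul hψ.1 hψ.conj.1 hq,
    eval_of_conjSeries_eq (conjSeries_mul_conjSeries_self ψ) q v,
    inv_mul_cancel_left₀ (hψ.eval_mul_conjSeries_ne_zero hq)]

variable {f g : ℍ[ℝ] → ℍ[ℝ]}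

theorem IsNonsingular.symm_ne_zero (hψ : IsNonsingular ψ) (hg : Represents ψ g)
    (hq : q ∈ unitBall) : symm g q ≠ 0 := by
  rw [symm, ← (hg.starMul hg.conj).eval_eq hq]
  exact hψ.eval_mul_conjSeries_ne_zero (mem_unitBall.mp hq)

theorem IsNonsingular.eval_starDiv (hψ : IsNonsingular ψ) (hf : Represents κ f)
    (hg : Represents ψ g) (hq : q ∈ unitBall) : eval ψ q (starDiv f g q) = eval κ q 1 := by
  have hq' := mem_unitBall.mp hq
  obtain ⟨v, hv⟩ := hψ.surjective hq' (eval κ q 1)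
  rw [starDiv, symm, ← (hg.starMul hg.conj).eval_eq hq, ← (hf.starMul hg.conj).eval_eq hq,
    hψ.inv_mul_eval_eq hf.mem_convergentSeries hq' hv, hv]

theorem IsNonsingular.exists_differentiableOn_quotient (hψ : IsNonsingular ψ)
    (hκ : κ ∈ convergentSeries ℍ[ℝ]) {I : ℍ[ℝ]} (hI : I ^ 2 = -1) (w : ℍ[ℝ]) :
    letI := sliceModule hI
    ∃ F : ℂ → ℍ[ℝ], DifferentiableOn ℂ F (Metric.ball 0 1) ∧ ∀ z v, ‖z‖ < 1 →
      eval ψ (sliceHom hI z) v = eval κ (sliceHom hI z) w → F z = v := by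
  obtain ⟨s, hs, hs_eq⟩ := exists_differentiableOn_sliceHom_eq_eval
    (conjSeries_mul_conjSeries_self ψ) (mul_mem hψ.1 hψ.conj.1) hI
  let _ := sliceModule hI
  refine ⟨fun z => (s z)⁻¹ • eval (κ * conjSeries ψ) (sliceHom hI z) w, fun z hz => ?_,
    fun z v hz hv => ?_⟩
  · have hz1 := mem_ball_zero_iff.mp hz
    have hs0 : s z ≠ 0 := by
      rw [← map_ne_zero (sliceHom hI), hs_eq z hz1]
      exact hψ.eval_mul_conjSeries_ne_zero (by rwa [norm_sliceHom])
    exact ((hs z hz).inv hs0).smul (hasDerivAt_eval_sliceHom hI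
      (mul_mem hκ hψ.conj.1) w hz1).differentiableAt.differentiableWithinAt
  · change sliceHom hI (s z)⁻¹ * _ = v
    rw [map_inv₀, hs_eq z hz, hψ.inv_mul_eval_eq hκ (by rwa [norm_sliceHom]) hv]

theorem IsNonsingular.norm_le_of_forall_sphere (hψ : IsNonsingular ψ)
    (hκ : κ ∈ convergentSeries ℍ[ℝ]) {r B : ℝ} (hr : r < 1)
    (hB : ∀ p u, ‖p‖ = r → eval ψ p u = eval κ p w → ‖u‖ ≤ B) (hq : ‖q‖ < r)
    (h : eval ψ q v = eval κ q w) : ‖v‖ ≤ B := by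
  have hr0 : r ≠ 0 := ((norm_nonneg q).trans_lt hq).ne'
  obtain ⟨z, hz⟩ := exists_sliceHom_eq q
  set hI := imUnit_sq q
  have hzr : ‖z‖ < r := by rwa [← norm_sliceHom hI, hz]
  let _ := sliceModule hI
  obtain ⟨F, hF_diff, hF⟩ := hψ.exists_differentiableOn_quotient hκ hI w
  have hF_sphere (ζ : ℂ) (hζ : ζ ∈ frontier (Metric.ball 0 r)) : ‖F ζ‖ ≤ B := by
    rw [frontier_ball _ hr0, mem_sphere_zero_iff_norm] at hζ
    have hζ' : ‖sliceHom hI ζ‖ = r := by rw [norm_sliceHom, hζ]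
    obtain ⟨u, hu⟩ := hψ.surjective (hζ'.trans_lt hr) (eval κ (sliceHom hI ζ) w)
    rw [hF ζ u (hζ.trans_lt hr) hu]
    exact hB _ u hζ' hu
  have hclosure : closure (Metric.ball (0 : ℂ) r) ⊆ Metric.ball 0 1 := by
    rw [closure_ball _ hr0]
    exact Metric.closedBall_subset_ball hr
  rw [← hF z v (hzr.trans hr) (by rwa [hz])]
  exact Complex.norm_le_of_forall_mem_frontier_norm_le Metric.isBounded_ball
    (hF_diff.mono hclosure).diffContOnCl hF_sphere (subset_closure (mem_ball_zero_iff.mpr hzr))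

end Nonsingular

section ContractiveQuotient

variable {η κ ρ ψ : ℍ[ℝ]⟦X⟧} {a p q u v w x : ℍ[ℝ]} {n : ℕ}

theorem norm_add_mul_sq_sub_norm_add_mul_star_sq (a v w : ℍ[ℝ]) :
    ‖v + w * a‖ ^ 2 - ‖w + v * star a‖ ^ 2 = (1 - ‖a‖ ^ 2) * (‖v‖ ^ 2 - ‖w‖ ^ 2) := by
  rw [norm_add_sq_real, norm_add_sq_real, norm_mul, norm_mul, norm_star, ← inner_mul_right,
    real_inner_comm v]
  ring

/-- The quotient of `κ` by `ψ` is a contraction: every solution `v` of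
`eval ψ q v = eval κ q w`, that is, every value of `(w * κ) * ψ⁻*`, is bounded by `w`. -/
def IsContractiveQuotient (κ ψ : ℍ[ℝ]⟦X⟧) : Prop :=
  ∀ ⦃q v w⦄, ‖q‖ < 1 → eval ψ q v = eval κ q w → ‖v‖ ≤ ‖w‖

theorem IsContractiveQuotient.isNonsingular (h : IsContractiveQuotient κ ψ)
    (hψ : ψ ∈ convergentSeries ℍ[ℝ]) : IsNonsingular ψ := by
  refine ⟨hψ, fun q hq v w hvw => sub_eq_zero.mp (norm_le_zero_iff.mp ?_)⟩
  rw [← norm_zero (E := ℍ[ℝ])]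
  refine h hq ?_
  have hadd := eval_add_right hψ hq (v - w) w
  rw [sub_add_cancel, hvw, right_eq_add] at hadd
  rw [hadd, eval_zero_right]

theorem isContractiveQuotient_sub_C_one_sub_C_mul (hη : η ∈ convergentSeries ℍ[ℝ])
    (hη_le : ∀ q w, ‖q‖ < 1 → ‖eval η q w‖ ≤ ‖w‖) (ha : ‖a‖ < 1) :
    IsContractiveQuotient (η - C a) (1 - C (star a) * η) := by
  intro q v w hq h
  rw [eval_one_sub_C_mul hη hq, eval_sub hη (C_mem_convergentSeries a) hq, eval_C,
    sub_eq_sub_iff_add_eq_add, ← eval_add_right hη hq] at h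
  have hle : ‖v + w * a‖ ^ 2 ≤ ‖w + v * star a‖ ^ 2 := by
    rw [h]
    exact pow_le_pow_left₀ (norm_nonneg _) (hη_le q _ hq) 2
  have ha2 : 0 < 1 - ‖a‖ ^ 2 := sub_pos.mpr (pow_lt_one₀ (norm_nonneg a) ha two_ne_zero)
  rw [← sub_nonpos, norm_add_mul_sq_sub_norm_add_mul_star_sq,
    mul_nonpos_iff_pos_imp_nonpos] at hle
  exact (sq_le_sq₀ (norm_nonneg v) (norm_nonneg w)).mp (sub_nonpos.mp (hle.1 ha2))

theorem isNonsingular_one_sub_C_mul_X (ha : ‖a‖ < 1) : IsNonsingular (1 - C (star a) * X) := by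
  refine (isContractiveQuotient_sub_C_one_sub_C_mul X_mem_convergentSeries (fun q w hq => ?_)
    ha).isNonsingular (one_sub_C_mul_mem_convergentSeries X_mem_convergentSeries _)
  rw [eval_X, norm_mul]
  exact mul_le_of_le_one_left (norm_nonneg w) hq.le

theorem exists_mul_sub_mul_eq (haq : ‖a‖ < ‖q‖) (w : ℍ[ℝ]) : ∃ v, q * v - v * a = w := by
  let sylvester : ℍ[ℝ] →ₗ[ℝ] ℍ[ℝ] := LinearMap.mulLeft ℝ q - LinearMap.mulRight ℝ a
  refine LinearMap.injective_iff_surjective (f := sylvester).mp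
    ((injective_iff_map_eq_zero sylvester).mpr fun v hv => ?_) w
  by_contra hv0
  have hnorm : ‖q * v‖ = ‖v * a‖ := congrArg norm (sub_eq_zero.mp hv)
  rw [norm_mul, norm_mul, mul_comm] at hnorm
  exact haq.ne' (mul_left_cancel₀ (norm_ne_zero_iff.mpr hv0) hnorm)

/-- For `‖p‖ = 1` this reads `‖x‖ ≤ ‖w‖`: the factors `X - a` and `1 - a̅ X` have the same modulus
on the unit sphere. The remaining terms measure the defect at radius `‖p‖ < 1`. -/
theorem norm_sq_le_of_mul_sub_mul_eq (ha : ‖a‖ ≤ 1) (hp : ‖p‖ ≤ 1)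
    (h : p * x - x * a = w - p * (w * star a)) :
    (1 - ‖a‖ ^ 2 - 2 * (1 - ‖p‖ ^ 2)) * ‖x‖ ^ 2 ≤
      (1 - ‖a‖ ^ 2 + 2 * (1 - ‖p‖ ^ 2)) * ‖w‖ ^ 2 := by
  rw [sub_eq_sub_iff_add_eq_add, ← mul_add] at h
  have hmoebius := norm_add_mul_sq_sub_norm_add_mul_star_sq a w x
  rw [← h, norm_mul, mul_pow] at hmoebius
  have hsum : ‖x + w * star a‖ ^ 2 ≤ 2 * (‖x‖ ^ 2 + ‖w‖ ^ 2) := by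
    refine (pow_le_pow_left₀ (norm_nonneg _) (norm_add_le_of_le le_rfl ?_) 2).trans add_sq_le
    rw [norm_mul, norm_star]
    exact mul_le_of_le_one_right (norm_nonneg w) ha
  have hp2 : 0 ≤ 1 - ‖p‖ ^ 2 := sub_nonneg.mpr (pow_le_one₀ (norm_nonneg p) hp)
  linarith [mul_le_mul_of_nonneg_left hsum hp2]

theorem IsContractiveQuotient.norm_sq_le_of_norm_lt {r : ℝ}
    (h : IsContractiveQuotient ((X - C a) * κ) ψ) (hκ : κ ∈ convergentSeries ℍ[ℝ])
    (hψ : ψ ∈ convergentSeries ℍ[ℝ]) (ha : ‖a‖ < 1) (hr : r < 1) (hq : ‖q‖ < r)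
    (hv : eval ψ q v = eval ((1 - C (star a) * X) * κ) q w) :
    (1 - ‖a‖ ^ 2 - 2 * (1 - r ^ 2)) * ‖v‖ ^ 2 ≤ (1 - ‖a‖ ^ 2 + 2 * (1 - r ^ 2)) * ‖w‖ ^ 2 := by
  have hr0 : 0 ≤ r := (norm_nonneg q).trans hq.le
  have hr2 : r ^ 2 < 1 := pow_lt_one₀ hr0 hr two_ne_zero
  have ha2 : ‖a‖ ^ 2 < 1 := pow_lt_one₀ (norm_nonneg a) ha two_ne_zero
  rcases le_or_gt (1 - ‖a‖ ^ 2 - 2 * (1 - r ^ 2)) 0 with hneg | hpos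
  · exact (mul_nonpos_of_nonpos_of_nonneg hneg (sq_nonneg _)).trans
      (mul_nonneg (by linarith) (sq_nonneg _))
  have har : ‖a‖ < r := lt_of_pow_lt_pow_left₀ 2 hr0 (by linarith)
  have hlin := one_sub_C_mul_mem_convergentSeries X_mem_convergentSeries (star a)
  have hsphere (p u : ℍ[ℝ]) (hp : ‖p‖ = r)
      (hu : eval ψ p u = eval ((1 - C (star a) * X) * κ) p w) :
      ‖u‖ ≤ √((1 - ‖a‖ ^ 2 + 2 * (1 - r ^ 2)) * ‖w‖ ^ 2 / (1 - ‖a‖ ^ 2 - 2 * (1 - r ^ 2))) := by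
    have hp1 : ‖p‖ < 1 := hp.trans_lt hr
    obtain ⟨x, hx⟩ := exists_mul_sub_mul_eq (hp ▸ har) (w - p * (w * star a))
    have hux : ‖u‖ ≤ ‖x‖ := by
      refine h hp1 ?_
      rw [hu, eval_mul hlin hκ hp1, eval_mul (X_sub_C_mem_convergentSeries a) hκ hp1,
        eval_one_sub_C_mul X_mem_convergentSeries hp1, eval_X, eval_X_sub_C hp1, hx]
    refine hux.trans (Real.le_sqrt_of_sq_le ((le_div_iff₀' hpos).mpr ?_))
    simpa only [hp] using norm_sq_le_of_mul_sub_mul_eq ha.le hp1.le hx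
  have hle := (h.isNonsingular hψ).norm_le_of_forall_sphere (mul_mem hlin hκ) hr hsphere hq hv
  rwa [Real.le_sqrt (norm_nonneg v) (by positivity), le_div_iff₀' hpos] at hle

theorem IsContractiveQuotient.replace_factor (h : IsContractiveQuotient ((X - C a) * κ) ψ)
    (hκ : κ ∈ convergentSeries ℍ[ℝ]) (hψ : ψ ∈ convergentSeries ℍ[ℝ]) (ha : ‖a‖ < 1) :
    IsContractiveQuotient ((1 - C (star a) * X) * κ) ψ := by
  intro q v w hq hv
  have hlim (c d s : ℝ) : Filter.Tendsto (fun r : ℝ => (c + d * (1 - r ^ 2)) * s) (𝓝[<] 1)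
      (𝓝 (c * s)) :=
    tendsto_nhdsWithin_of_tendsto_nhds (Continuous.tendsto' (by fun_prop) _ _ (by ring))
  have hle := le_of_tendsto_of_tendsto (hlim (1 - ‖a‖ ^ 2) (-2) (‖v‖ ^ 2))
    (hlim (1 - ‖a‖ ^ 2) 2 (‖w‖ ^ 2)) ?_
  · have ha2 : 0 < 1 - ‖a‖ ^ 2 := sub_pos.mpr (pow_lt_one₀ (norm_nonneg a) ha two_ne_zero)
    exact (sq_le_sq₀ (norm_nonneg v) (norm_nonneg w)).mp (le_of_mul_le_mul_left hle ha2)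
  · filter_upwards [self_mem_nhdsWithin, Ioo_mem_nhdsLT hq] with r hr hqr
    rw [neg_mul, ← sub_eq_add_neg]
    exact h.norm_sq_le_of_norm_lt hκ hψ ha hr hqr.1 hv

theorem IsContractiveQuotient.replace_factor_pow (n : ℕ)
    (h : IsContractiveQuotient ((X - C a) ^ n * κ) ψ) (hκ : κ ∈ convergentSeries ℍ[ℝ])
    (hψ : ψ ∈ convergentSeries ℍ[ℝ]) (ha : ‖a‖ < 1) :
    IsContractiveQuotient ((1 - C (star a) * X) ^ n * κ) ψ := by
  induction n generalizing κ with
  | zero => simpa only [pow_zero] using h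
  | succ n ih =>
    rw [pow_succ', mul_assoc] at h
    have hreplaced := h.replace_factor
      (mul_mem (pow_mem (X_sub_C_mem_convergentSeries a) n) hκ) hψ ha
    have hcomm := (commute_X_sub_C_one_sub_C_mul_X (star_comm_self' a).symm).pow_left n
    rw [← mul_assoc, ← hcomm.eq, mul_assoc] at hreplaced
    rw [pow_succ, mul_assoc]
    exact ih hreplaced
      (mul_mem (one_sub_C_mul_mem_convergentSeries X_mem_convergentSeries _) hκ)

theorem eval_one_sub_C_mul_X_self (ha : ‖a‖ < 1) (r : ℝ) :
    eval (1 - C (star a) * X) a r = ((1 - ‖a‖ ^ 2 : ℝ) : ℍ[ℝ]) * r := by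
  rw [eval_one_sub_C_mul X_mem_convergentSeries ha, eval_X, Quaternion.coe_commutes, ← mul_assoc,
    Quaternion.self_mul_star, Quaternion.normSq_eq_norm_mul_self, ← sq, ← one_sub_mul,
    Quaternion.coe_sub, Quaternion.coe_one]

theorem eval_one_sub_C_mul_X_pow_self (ha : ‖a‖ < 1) (n : ℕ) (r : ℝ) :
    eval ((1 - C (star a) * X) ^ n) a r = (((1 - ‖a‖ ^ 2) ^ n * r : ℝ) : ℍ[ℝ]) := by
  have hlin := one_sub_C_mul_mem_convergentSeries (X_mem_convergentSeries (R := ℍ[ℝ])) (star a)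
  induction n with
  | zero => rw [pow_zero, eval_one, pow_zero, one_mul]
  | succ n ih =>
    rw [pow_succ, eval_mul (pow_mem hlin n) hlin ha, ih, eval_one_sub_C_mul_X_self ha,
      ← Quaternion.coe_mul, ← mul_assoc, ← pow_succ']

theorem IsContractiveQuotient.norm_le_of_eval_eq_eval_pow
    (h : IsContractiveQuotient ((1 - C (star a) * X) ^ n * ρ) ψ) (hρ : ρ ∈ convergentSeries ℍ[ℝ])
    (hq : ‖q‖ < 1) (hv : eval ψ q v = eval ((X - C a) ^ n * ρ) q w)
    (hu : eval ((1 - C (star a) * X) ^ n) q u = eval ((X - C a) ^ n) q w) : ‖v‖ ≤ ‖u‖ := by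
  refine h hq ?_
  rw [hv, eval_mul (pow_mem (X_sub_C_mem_convergentSeries a) n) hρ hq, ← hu,
    eval_mul (pow_mem (one_sub_C_mul_mem_convergentSeries X_mem_convergentSeries _) n) hρ hq]

theorem IsContractiveQuotient.norm_le_div_pow
    (h : IsContractiveQuotient ((1 - C (star a) * X) ^ n * ρ) ψ) (hρ : ρ ∈ convergentSeries ℍ[ℝ])
    (ha : ‖a‖ < 1) {r : ℝ} (hr : 0 ≤ r) (hv : eval ψ a v = eval ρ a r) :
    ‖v‖ ≤ r / (1 - ‖a‖ ^ 2) ^ n := by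
  have ha2 : 0 < (1 - ‖a‖ ^ 2) ^ n :=
    pow_pos (sub_pos.mpr (pow_lt_one₀ (norm_nonneg a) ha two_ne_zero)) n
  have hle : ‖v‖ ≤ ‖((r / (1 - ‖a‖ ^ 2) ^ n : ℝ) : ℍ[ℝ])‖ := by
    refine h ha ?_
    rw [hv, eval_mul (pow_mem (one_sub_C_mul_mem_convergentSeries X_mem_convergentSeries _) n) hρ
      ha, eval_one_sub_C_mul_X_pow_self ha, mul_div_cancel₀ _ ha2.ne']
  rwa [Quaternion.norm_coe, Real.norm_of_nonneg (div_nonneg hr ha2.le)] at hle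

theorem Represents.norm_eval_le {f : ℍ[ℝ] → ℍ[ℝ]} (hf : Represents η f)
    (hmaps : Set.MapsTo f unitBall unitBall)
    (q w : ℍ[ℝ]) (hq : ‖q‖ < 1) : ‖eval η q w‖ ≤ ‖w‖ := by
  refine (norm_eval_le_of_forall_eval_one (B := 1) (fun p hp => ?_) hq w).trans_eq (one_mul _)
  rw [hf.eval_eq (mem_unitBall.mpr hp)]
  exact (mem_unitBall.mp (hmaps (mem_unitBall.mpr hp))).le

theorem exists_sub_C_eq_X_sub_C_pow_mul (hη : η ∈ convergentSeries ℍ[ℝ]) (ha : ‖a‖ < 1)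
    (hn : n ≠ 0) (hvanish : ∀ m, m ≠ 0 → m < n → eval (derivative^[m] η) a 1 = 0) :
    ∃ ρ ∈ convergentSeries ℍ[ℝ], η - C (eval η a 1) = (X - C a) ^ n * ρ ∧
      eval (derivative^[n] η) a 1 = eval ρ a (n ! : ℝ) := by
  have : IsAddTorsionFree ℍ[ℝ] := .of_isTorsionFree ℝ ℍ[ℝ]
  have hC := C_mem_convergentSeries (eval η a 1)
  obtain ⟨ρ, hρ, hfactor, hlead⟩ := exists_eq_X_sub_C_pow_mul (sub_mem hη hC) ha n fun m hm => by
    rcases eq_or_ne m 0 with rfl | hm0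
    · rw [Function.iterate_zero_apply, eval_sub hη hC ha, eval_C, one_mul, sub_self]
    · rw [iterate_derivative_sub_C _ _ hm0, hvanish m hm0 hm]
  refine ⟨ρ, hρ, hfactor, ?_⟩
  rw [iterate_derivative_sub_C _ _ hn] at hlead
  rw [hlead, ← Nat.cast_smul_eq_nsmul ℝ, ← eval_smul_right hρ ha, ← Quaternion.coe_mul_eq_smul,
    mul_one]

end ContractiveQuotient

end SliceRegular

end

theorem mainTheorem6 (f : ℍ[ℝ] → ℍ[ℝ])
    (hf : SliceRegular.IsRegularOn f SliceRegular.unitBall)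
    (hmaps : Set.MapsTo f SliceRegular.unitBall SliceRegular.unitBall)
    (q₀ : ℍ[ℝ]) (hq₀ : q₀ ∈ SliceRegular.unitBall) (n : ℕ) (hn : 1 ≤ n)
    (hvanish : ∀ m : ℕ, 1 ≤ m → m ≤ n - 1 → (SliceRegular.cullenDeriv^[m] f) q₀ = 0) :
    (∀ q ∈ SliceRegular.unitBall,
      SliceRegular.symm (SliceRegular.oneSubStar (f q₀) f) q ≠ 0) ∧
    (∀ q ∈ SliceRegular.unitBall,
      ‖SliceRegular.starDiv (fun p => f p - f q₀) (SliceRegular.oneSubStar (f q₀) f) q‖ ≤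
        ‖SliceRegular.starDiv (SliceRegular.starPow (fun p => p - q₀) n)
          (SliceRegular.starPow (SliceRegular.oneSubStar q₀ (fun p => p)) n) q‖) ∧
    ‖SliceRegular.starDiv (SliceRegular.cullenDeriv^[n] f)
        (SliceRegular.oneSubStar (f q₀) f) q₀‖ ≤
      (n ! : ℝ) / (1 - ‖q₀‖ ^ 2) ^ n := by
  open SliceRegular in
  obtain ⟨η, hη⟩ := hf.exists_represents
  have hηc := hη.mem_convergentSeries
  have hq₀' := mem_unitBall.mp hq₀
  have hψ := hη.oneSubStar (f q₀)
  have hquotient := isContractiveQuotient_sub_C_one_sub_C_mul hηc (hη.norm_eval_le hmaps)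
    (mem_unitBall.mp (hmaps hq₀))
  have hnonsing := hquotient.isNonsingular hψ.mem_convergentSeries
  obtain ⟨ρ, hρ, hfactor, hlead⟩ := exists_sub_C_eq_X_sub_C_pow_mul hηc hq₀' (by lia : n ≠ 0)
    fun m hm0 hmn => ((hη.iterate_cullenDeriv m).eval_eq hq₀).trans
      (hvanish m (by lia) (by lia))
  rw [hη.eval_eq hq₀] at hfactor
  rw [hfactor] at hquotient
  have hreplaced := hquotient.replace_factor_pow n hρ hψ.mem_convergentSeries hq₀'
  refine ⟨fun q hq => hnonsing.symm_ne_zero hψ hq, fun q hq => ?_, ?_⟩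
  · refine hreplaced.norm_le_of_eval_eq_eval_pow hρ (mem_unitBall.mp hq) (w := 1) ?_ ?_
    · rw [hnonsing.eval_starDiv (hη.sub (represents_const _)) hψ hq, hfactor]
    · exact ((isNonsingular_one_sub_C_mul_X hq₀').pow n).eval_starDiv
        ((represents_id.sub (represents_const q₀)).starPow n)
        ((represents_id.oneSubStar q₀).starPow n) hq
  · refine hreplaced.norm_le_div_pow hρ hq₀' (Nat.cast_nonneg _) ?_
    rw [hnonsing.eval_starDiv (hη.iterate_cullenDeriv n) hψ hq₀, hlead]
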